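/- Sizes, with values in $\mathbb{N}\cup\{+\infty\}$, are defined as follows. A rational number $r=p/q$ with $p,q$ coprime integers has size $\|r\| = 1+\lceil\log_2(|p|+1)\rceil+\lceil\log_2(|q|+1)\rceil$, and an irrational number has size $+\infty$. For a finite set $D$, a point $x\in\mathbb{R}^D$ has size $\|x\| = \operatorname{card} D+\sum_{d\in D}\|x_d\|$; a finite set $X\subseteq\mathbb{R}^D$ has size $\|X\| = \operatorname{card} X+\sum_{x\in X}\|x\|$; and a pair $(a,b)\in\mathbb{R}^D\times\mathbb{R}$ has size $\|(a,b)\| = 2+\|a\|+\|b\|$. A linear inequation in $\mathbb{R}^D$ is a pair $(a,b)$ with $a\in\mathbb{R}^D\setminus\{0\}$ and $b\in\mathbb{R}$. A system of linear inequations is a finite set $\Sigma$ of linear inequations, and its solution set is $$\mathsf{Sol}_\geq(\Sigma)=\{x\in\mathbb{R}^D \mid a\cdot x\geq b \text{ for every } (a,b)\in\Sigma\}.$$ **Lemma.** There exists a polynomial $P_2$ with coefficients in $\mathbb{N}$ such that, for every finite set $D$ and every nonempty finite subset $X\subseteq\mathbb{R}^D$, there exists a system of linear inequations $\Sigma$ in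 $\mathbb{R}^D$ such that $\mathsf{Sol}_\geq(\Sigma)=\mathsf{Conv}(X)$, the convex hull of $X$, and $\|(a,b)\|\leq P_2(\|X\|)$ for every $(a,b)\in\Sigma$. (If $\|X\|=+\infty$, the value $P_2(+\infty)$ is $+\infty$ when $P_2$ is not constant, and the constant value of $P_2$ otherwise.) -/

import Mathlib

/-- The size `1 + ⌈log₂ (|p| + 1)⌉ + ⌈log₂ (q + 1)⌉` of the rational number `p / q` in lowest terms
(`Nat.clog 2 n` is `⌈log₂ n⌉`, see `ratSize_eq_ceil_logb`). -/
def ratSize (r : ℚ) : ℕ :=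
  1 + Nat.clog 2 (r.num.natAbs + 1) + Nat.clog 2 (r.den + 1)

theorem ratSize_eq_ceil_logb (r : ℚ) :
    (ratSize r : ℤ) =
      1 + ⌈Real.logb 2 (|(r.num : ℝ)| + 1)⌉ + ⌈Real.logb 2 ((r.den : ℝ) + 1)⌉ := by
  have key : ∀ n : ℕ, ⌈Real.logb 2 ((n : ℝ) + 1)⌉ = (Nat.clog 2 (n + 1) : ℤ) := by
    intro n
    have h := Real.ceil_logb_natCast (b := 2) (r := ((n + 1 : ℕ) : ℝ)) (by positivity)
    rw [Int.clog_natCast] at h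
    exact_mod_cast h
  have hn : |(r.num : ℝ)| = (r.num.natAbs : ℝ) := by
    rw [Nat.cast_natAbs, Int.cast_abs]
  rw [hn, key, key, ratSize]
  push_cast
  ring

open Classical in
/-- The size of a real number: that of the corresponding rational number if it is rational,
and `+∞` if it is irrational. -/
noncomputable def realSize (x : ℝ) : ℕ∞ :=
  if h : ∃ q : ℚ, (q : ℝ) = x then (ratSize h.choose : ℕ∞) else ⊤

theorem realSize_ratCast (q : ℚ) : realSize (q : ℝ) = (ratSize q : ℕ∞) := by
  have h : ∃ q' : ℚ, (q' : ℝ) = (q : ℝ) := ⟨q, rfl⟩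
  have h' : h.choose = q := Rat.cast_injective h.choose_spec
  rw [realSize, dif_pos h, h']

theorem realSize_of_irrational {x : ℝ} (hx : Irrational x) : realSize x = ⊤ :=
  dif_neg hx

/-- The size `card D + ∑ d, ‖x d‖` of a point `x` of `ℝ^D`. -/
noncomputable def pointSize {D : Type*} [Fintype D] (x : D → ℝ) : ℕ∞ :=
  (Fintype.card D : ℕ∞) + ∑ d, realSize (x d)

/-- The size `card X + ∑ x ∈ X, ‖x‖` of a finite set `X` of points of `ℝ^D`. -/
noncomputable def pointSetSize {D : Type*} [Fintype D] (X : Finset (D → ℝ)) : ℕ∞ :=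
  (X.card : ℕ∞) + ∑ x ∈ X, pointSize x

/-- A linear inequation `(a, b)` in `ℝ^D`: a nonzero vector `a` and a real number `b`. -/
abbrev LinearInequation (D : Type*) : Type _ :=
  {a : D → ℝ // a ≠ 0} × ℝ

/-- The solution set `{x | a · x ≥ b}` of the linear inequation `(a, b)`. -/
def LinearInequation.sol {D : Type*} [Fintype D] (e : LinearInequation D) : Set (D → ℝ) :=
  {x | ∑ d, e.1.1 d * x d ≥ e.2}

/-- The size `2 + ‖a‖ + ‖b‖` of the pair `(a, b)`, a tuple with two components. -/
noncomputable def LinearInequation.size {D : Type*} [Fintype D] (e : LinearInequation D) : ℕ∞ :=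
  2 + (pointSize e.1.1 + realSize e.2)

/-- The solution set of a system of linear inequations, i.e. of a finite set of them. -/
def systemSol {D : Type*} [Fintype D] (S : Finset (LinearInequation D)) : Set (D → ℝ) :=
  ⋂ e ∈ S, e.sol

/-- The value of a polynomial with natural coefficients at an extended natural number,
with `k * ∞ = ∞` for `k ≠ 0`, so that a non-constant polynomial has the value `∞` at `∞`. -/
noncomputable def polyValue (P : Polynomial ℕ) (n : ℕ∞) : ℕ∞ :=
  P.eval₂ (Nat.castRingHom ℕ∞) n

/-! Write an inequation `(a, b)` as the vector `c = (a, -b)`. It holds on `X` iff `c` lies in the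
dual cone of the points `(x, 1)`, and by Hahn–Banach this cone cuts out `Conv(X)`. Truncating it by
the box `[-1, 1]` gives a compact polyhedron. Its finitely many extreme points suffice, since a
linear form attains its minimum at one of them (`exists_extremePoint_boxedCone_neg`,
`exists_system_convexHull`). An extreme point solves a nonsingular square subsystem of tight
constraints (`exists_active_basis`). After clearing denominators row by row, Cramer's rule bounds
the denominators of its coordinates by an integer determinant, hence by `2 ^ (2 * N ^ 2)`; the box
makes the numerators no larger (`exists_rat_of_mem_extremePoints_boxedCone`). -/

/-! ### Extreme points of polyhedra -/

/-- The polyhedron `{c | r j ⬝ᵥ c ≥ β j for all j}`. -/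
def polyhedron {ι n : Type*} [Fintype n] (r : ι → n → ℝ) (β : ι → ℝ) : Set (n → ℝ) :=
  {c | ∀ j, β j ≤ r j ⬝ᵥ c}

/-- Otherwise some `z ≠ 0` is orthogonal to all active rows. Since the finitely many other
constraints have slack, `c ± ε z` stay in the polyhedron for small `ε`, and `c` is their midpoint.
-/
theorem span_active_eq_top {ι n : Type*} [Finite ι] [Fintype n] {r : ι → n → ℝ} {β : ι → ℝ}
    {c : n → ℝ} (hc : c ∈ Set.extremePoints ℝ (polyhedron r β)) :
    Submodule.span ℝ (r '' {j | r j ⬝ᵥ c = β j}) = ⊤ := by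
  classical
  by_contra hne
  obtain ⟨φ, hφ, hle⟩ := Submodule.exists_le_ker_of_lt_top _ (lt_top_iff_ne_top.2 hne)
  set z : n → ℝ := fun i => φ (Pi.single i 1) with hz
  have hφz : ∀ v, φ v = v ⬝ᵥ z := by
    intro v
    rw [LinearMap.pi_apply_eq_sum_univ φ v]
    simp only [dotProduct, hz, smul_eq_mul]
    refine Finset.sum_congr rfl fun i _ => ?_
    congr 2
    ext j
    simp [Pi.single_apply, eq_comm]
  have hz0 : z ≠ 0 := by
    intro h
    apply hφ
    ext v
    simp [hφz, h]
  have hact : ∀ j, r j ⬝ᵥ c = β j → r j ⬝ᵥ z = 0 := by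
    intro j hj
    rw [← hφz]
    exact hle (Submodule.subset_span ⟨j, hj, rfl⟩)
  have hev : ∀ᶠ ε : ℝ in nhdsWithin 0 (Set.Ioi 0),
      ∀ j, r j ⬝ᵥ c ≠ β j → ε * |r j ⬝ᵥ z| < r j ⬝ᵥ c - β j := by
    refine Filter.eventually_all.2 fun j => ?_
    by_cases hj : r j ⬝ᵥ c = β j
    · simp [hj]
    have hpos : 0 < r j ⬝ᵥ c - β j := sub_pos.2 (lt_of_le_of_ne (hc.1 j) (Ne.symm hj))
    have ht : Filter.Tendsto (fun ε : ℝ => ε * |r j ⬝ᵥ z|) (nhds 0) (nhds 0) := by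
      have : Continuous fun ε : ℝ => ε * |r j ⬝ᵥ z| := by fun_prop
      simpa using this.tendsto 0
    filter_upwards [(ht.mono_left nhdsWithin_le_nhds).eventually (gt_mem_nhds hpos)] with ε hε _
    exact hε
  obtain ⟨ε, hε, hε0⟩ := (hev.and self_mem_nhdsWithin).exists
  have hε0 : 0 < ε := hε0
  have hmem : ∀ s : ℝ, |s| = 1 → c + (s * ε) • z ∈ polyhedron r β := by
    intro s hs j
    rw [dotProduct_add, dotProduct_smul, smul_eq_mul]
    by_cases hj : r j ⬝ᵥ c = β j
    · simp [hact j hj, hj]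
    · have h1 := hε j hj
      have h2 : -(ε * |r j ⬝ᵥ z|) ≤ s * ε * r j ⬝ᵥ z := by
        have := neg_abs_le (s * ε * r j ⬝ᵥ z)
        rwa [abs_mul, abs_mul, hs, one_mul, abs_of_pos hε0] at this
      linarith
  have h1 := hmem 1 (by simp)
  have h2 := hmem (-1) (by simp)
  have hseg : c ∈ openSegment ℝ (c + (1 * ε) • z) (c + ((-1) * ε) • z) := by
    refine ⟨1 / 2, 1 / 2, by norm_num, by norm_num, by norm_num, ?_⟩
    module
  have h3 := hc.2 h1 h2 hseg
  apply hz0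
  have : (1 * ε) • z = 0 := by simpa using h3
  rcases smul_eq_zero.1 this with h | h
  · exact absurd h (by simpa using hε0.ne')
  · exact h

theorem exists_active_basis {ι n : Type*} [Finite ι] [Fintype n] [DecidableEq n]
    {r : ι → n → ℝ} {β : ι → ℝ} {c : n → ℝ} (hc : c ∈ Set.extremePoints ℝ (polyhedron r β)) :
    ∃ f : n → ι, (Matrix.of fun i => r (f i)).det ≠ 0 ∧ ∀ i, r (f i) ⬝ᵥ c = β (f i) := by
  have hs := span_active_eq_top hc
  let b := Module.Basis.ofSpan hs.ge
  let b' := b.reindex (b.indexEquiv (Pi.basisFun ℝ n))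
  have hb : ∀ i, ∃ j, r j ⬝ᵥ c = β j ∧ r j = b' i := by
    intro i
    have : b' i ∈ r '' {j | r j ⬝ᵥ c = β j} := by
      apply Module.Basis.ofSpan_subset hs.ge
      rw [Module.Basis.reindex_apply]
      exact ⟨_, rfl⟩
    obtain ⟨j, hj, hj'⟩ := this
    exact ⟨j, hj, hj'⟩
  choose f hf hf' using hb
  refine ⟨f, ?_, hf⟩
  have hli : LinearIndependent ℝ (Matrix.of fun i => r (f i)).row := by
    have : (Matrix.of fun i => r (f i)).row = b' := by
      ext i
      simp [Matrix.row, hf']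
    rw [this]
    exact b'.linearIndependent
  have := (Matrix.isUnit_iff_isUnit_det _).1 (Matrix.linearIndependent_rows_iff_isUnit.1 hli)
  exact this.ne_zero

/-- The choice of a basis of active rows determines the extreme point, and there are finitely many
choices. -/
theorem finite_extremePoints_polyhedron {ι n : Type*} [Finite ι] [Fintype n]
    (r : ι → n → ℝ) (β : ι → ℝ) : (Set.extremePoints ℝ (polyhedron r β)).Finite := by
  classical
  refine (Set.finite_range fun f : n → ι =>
    (Matrix.of fun i => r (f i))⁻¹.mulVec fun i => β (f i)).subset ?_
  intro c hc
  obtain ⟨f, hdet, hf⟩ := exists_active_basis hc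
  refine ⟨f, ?_⟩
  have : (fun i => β (f i)) = (Matrix.of fun i => r (f i)).mulVec c := by
    ext i
    simp [Matrix.mulVec, hf]
  simp only [this, Matrix.mulVec_mulVec]
  rw [Matrix.nonsing_inv_mul _ (isUnit_iff_ne_zero.2 hdet), Matrix.one_mulVec]

/-! ### The dual cone truncated by the unit box -/

/-- The rows of the system `V j ⬝ᵥ c ≥ 0`, `c i ≥ -1`, `-c i ≥ -1`. -/
def boxedConeRow {ι n : Type*} [DecidableEq n] (V : ι → n → ℝ) : ι ⊕ n ⊕ n → n → ℝ :=
  Sum.elim V (Sum.elim (fun i => Pi.single i 1) fun i => -Pi.single i 1)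

/-- The right-hand sides of the system `V j ⬝ᵥ c ≥ 0`, `c i ≥ -1`, `-c i ≥ -1`. -/
def boxedConeBound {ι n : Type*} : ι ⊕ n ⊕ n → ℝ :=
  Sum.elim (fun _ => 0) fun _ => -1

theorem mem_boxedCone {ι n : Type*} [Fintype n] [DecidableEq n] {V : ι → n → ℝ} {c : n → ℝ} :
    c ∈ polyhedron (boxedConeRow V) boxedConeBound ↔
      (∀ j, 0 ≤ V j ⬝ᵥ c) ∧ c ∈ Set.Icc (fun _ => -1 : n → ℝ) (fun _ => 1) := by
  simp [polyhedron, boxedConeRow, boxedConeBound, Set.mem_Icc, Pi.le_def]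

theorem isCompact_boxedCone {ι n : Type*} [Fintype n] [DecidableEq n] (V : ι → n → ℝ) :
    IsCompact (polyhedron (boxedConeRow V) boxedConeBound) := by
  have : polyhedron (boxedConeRow V) boxedConeBound =
      (⋂ j, {c | 0 ≤ V j ⬝ᵥ c}) ∩ Set.Icc (fun _ => -1 : n → ℝ) (fun _ => 1) := by
    ext c
    simp only [mem_boxedCone, Set.mem_inter_iff, Set.mem_iInter, Set.mem_ofPred_eq]
  rw [this]
  refine isCompact_Icc.inter_left (isClosed_iInter fun j => isClosed_le continuous_const ?_)
  exact Continuous.dotProduct continuous_const continuous_id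

/-- If some vector of the dual cone of `V` is negative at `y`, so is an extreme point of the
intersection of this cone with the unit box. -/
theorem exists_extremePoint_boxedCone_neg {ι n : Type*} [Fintype n] [DecidableEq n]
    {V : ι → n → ℝ} {y c : n → ℝ} (hc : ∀ j, 0 ≤ V j ⬝ᵥ c) (hy : y ⬝ᵥ c < 0) :
    ∃ c' ∈ Set.extremePoints ℝ (polyhedron (boxedConeRow V) boxedConeBound), y ⬝ᵥ c' < 0 := by
  have hcomp := isCompact_boxedCone V
  let φ : (n → ℝ) →L[ℝ] ℝ := LinearMap.toContinuousLinearMap (-(dotProductBilin ℝ ℝ y))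
  have hφ : ∀ x, φ x = -(y ⬝ᵥ x) := fun x => rfl
  have h0 : (0 : n → ℝ) ∈ polyhedron (boxedConeRow V) boxedConeBound := by
    simp [mem_boxedCone, Pi.le_def]
  obtain ⟨m, hm, hmax⟩ := hcomp.exists_isMaxOn ⟨0, h0⟩ φ.continuous.continuousOn
  -- The minimizers of `y ⬝ᵥ ·` form an exposed face, whose extreme points are extreme in the whole
  -- polyhedron.
  have hexp := ContinuousLinearMap.toExposed.isExposed (l := φ) (A := polyhedron (boxedConeRow V) boxedConeBound)
  have hne : (φ.toExposed (polyhedron (boxedConeRow V) boxedConeBound)).Nonempty :=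
    ⟨m, hm, fun x hx => hmax hx⟩
  obtain ⟨e, he⟩ := (hexp.isCompact hcomp).extremePoints_nonempty hne
  refine ⟨e, hexp.isExtreme.extremePoints_subset_extremePoints he, ?_⟩
  -- Scaling by `s` brings `c` into the box and keeps the sign at `y`.
  set s : ℝ := (1 + ∑ i, |c i|)⁻¹
  have hsum : 0 ≤ ∑ i, |c i| := Finset.sum_nonneg fun _ _ => abs_nonneg _
  have hs : 0 < s := by positivity
  have hle : ∀ i, |s * c i| ≤ 1 := by
    intro i
    have : |c i| ≤ ∑ i, |c i| :=
      Finset.single_le_sum (f := fun i => |c i|) (fun _ _ => abs_nonneg _) (Finset.mem_univ i)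
    rw [abs_mul, abs_of_pos hs, inv_mul_le_iff₀ (by positivity)]
    linarith
  have hsc : s • c ∈ polyhedron (boxedConeRow V) boxedConeBound := by
    rw [mem_boxedCone]
    refine ⟨fun j => ?_, fun i => (abs_le.1 (hle i)).1, fun i => (abs_le.1 (hle i)).2⟩
    rw [dotProduct_smul, smul_eq_mul]
    exact mul_nonneg hs.le (hc j)
  have h1 := (extremePoints_subset he).2 (s • c) hsc
  rw [hφ, hφ, dotProduct_smul, smul_eq_mul] at h1
  have := mul_neg_of_pos_of_neg hs hy
  linarith

/-! ### Inequations for the convex hull -/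

/-- The homogenization `(x, 1)` of a point `x`. -/
def homogenize {D : Type*} (x : D → ℝ) : Option D → ℝ :=
  fun o => o.elim 1 x

theorem homogenize_dotProduct {D : Type*} [Fintype D] (x : D → ℝ) (c : Option D → ℝ) :
    homogenize x ⬝ᵥ c = c none + ∑ d, c (some d) * x d := by
  simp [dotProduct, homogenize, Fintype.sum_option, mul_comm]

/-- A functional `f` with `f y < u < f x` on the hull yields `c = (f, -u)`. -/
theorem exists_dual_neg_of_notMem_convexHull {D : Type*} [Fintype D] {X : Set (D → ℝ)}
    (hX : X.Finite) {y : D → ℝ} (hy : y ∉ convexHull ℝ X) :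
    ∃ c : Option D → ℝ, (∀ x ∈ X, 0 ≤ homogenize x ⬝ᵥ c) ∧ homogenize y ⬝ᵥ c < 0 := by
  classical
  obtain ⟨f, u, hfy, hfX⟩ := geometric_hahn_banach_point_closed (convex_convexHull ℝ X)
    (hX.isCompact_convexHull ℝ).isClosed hy
  have hf : ∀ x, ∑ d, f (Pi.single d 1) * x d = f x := by
    intro x
    conv_rhs => rw [← Finset.univ_sum_single x]
    rw [map_sum]
    refine Finset.sum_congr rfl fun d _ => ?_
    rw [mul_comm, ← smul_eq_mul, ← map_smul, ← Pi.single_smul]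
    simp
  refine ⟨fun o => o.elim (-u) fun d => f (Pi.single d 1), fun x hx => ?_, ?_⟩
  · rw [homogenize_dotProduct]
    simp only [Option.elim, hf]
    linarith [hfX x (subset_convexHull ℝ X hx)]
  · rw [homogenize_dotProduct]
    simp only [Option.elim, hf]
    linarith

/-- The extreme points `(a, -b)` with `a ≠ 0` of the boxed dual cone of the homogenization of a
nonempty finite set `X` form a system of linear inequations for the convex hull of `X`. -/
theorem exists_system_convexHull {D : Type*} [Fintype D] [DecidableEq D] (X : Finset (D → ℝ))
    (hX : X.Nonempty) :
    ∃ S : Finset (LinearInequation D), systemSol S = convexHull ℝ (X : Set (D → ℝ)) ∧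
      ∀ e ∈ S, (fun o : Option D => o.elim (-e.2) e.1.1) ∈ Set.extremePoints ℝ
        (polyhedron (boxedConeRow fun x : X => homogenize x.1) boxedConeBound) := by
  set E := Set.extremePoints ℝ
    (polyhedron (boxedConeRow fun x : X => homogenize x.1) boxedConeBound) with hE
  let g : LinearInequation D → Option D → ℝ := fun e o => o.elim (-e.2) e.1.1
  have hg : Function.Injective g := by
    rintro ⟨⟨a, ha⟩, b⟩ ⟨⟨a', ha'⟩, b'⟩ h
    have h1 : a = a' := funext fun d => congrFun h (some d)
    have h2 : -b = -b' := congrFun h none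
    simp only [Prod.mk.injEq, Subtype.mk.injEq]
    exact ⟨h1, neg_injective h2⟩
  have hfin : (g ⁻¹' E).Finite :=
    (finite_extremePoints_polyhedron _ _).preimage hg.injOn
  have hsol : ∀ (e : LinearInequation D) (y : D → ℝ),
      y ∈ e.sol ↔ 0 ≤ homogenize y ⬝ᵥ g e := by
    intro e y
    rw [homogenize_dotProduct]
    simp only [LinearInequation.sol, Set.mem_ofPred_eq, g, Option.elim, ge_iff_le]
    constructor <;> intro h <;> linarith
  refine ⟨hfin.toFinset, ?_, fun e he => by simpa using he⟩
  apply Set.Subset.antisymm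
  · intro y hy
    by_contra hyX
    obtain ⟨c, hcX, hcy⟩ := exists_dual_neg_of_notMem_convexHull X.finite_toSet hyX
    obtain ⟨c', hc', hcy'⟩ := exists_extremePoint_boxedCone_neg
      (V := fun x : X => homogenize x.1) (fun x => hcX x.1 x.2) hcy
    -- With zero linear part, `c'` would take the same value at `y` and at a point of `X`, but the
    -- former is negative and the latter is not.
    have hne : (fun d => c' (some d)) ≠ 0 := by
      intro h0
      obtain ⟨x, hx⟩ := hX
      have h1 := (mem_boxedCone.1 hc'.1).1 ⟨x, hx⟩
      have h2 : ∀ d, c' (some d) = 0 := fun d => congrFun h0 d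
      simp only [homogenize_dotProduct, h2, zero_mul, Finset.sum_const_zero] at h1 hcy'
      linarith
    let e : LinearInequation D := (⟨fun d => c' (some d), hne⟩, -c' none)
    have hge : g e = c' := by
      ext o
      cases o <;> simp [g, e]
    have heS : e ∈ hfin.toFinset := by
      rw [Set.Finite.mem_toFinset, Set.mem_preimage, hge]
      exact hc'
    have := (hsol e y).1 (Set.mem_iInter₂.1 hy e heS)
    rw [hge] at this
    linarith
  · refine convexHull_min ?_ ?_
    · intro x hx
      refine Set.mem_iInter₂.2 fun e he => (hsol e x).2 ?_
      have he' : g e ∈ E := by simpa using he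
      exact (mem_boxedCone.1 he'.1).1 ⟨x, hx⟩
    · refine convex_iInter₂ fun e _ => ?_
      have : IsLinearMap ℝ fun x : D → ℝ => ∑ d, e.1.1 d * x d :=
        ⟨fun x y => dotProduct_add e.1.1 x y, fun k x => dotProduct_smul k e.1.1 x⟩
      exact convex_halfSpace_ge this _

/-! ### Sizes, determinants and Cramer's rule -/

theorem natAbs_num_le_two_pow_ratSize (q : ℚ) : q.num.natAbs ≤ 2 ^ ratSize q := by
  have h := Nat.le_pow_clog one_lt_two (q.num.natAbs + 1)
  have h2 : 2 ^ Nat.clog 2 (q.num.natAbs + 1) ≤ 2 ^ ratSize q :=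
    Nat.pow_le_pow_right two_pos (by unfold ratSize; omega)
  omega

theorem den_le_two_pow_ratSize (q : ℚ) : q.den ≤ 2 ^ ratSize q := by
  have h := Nat.le_pow_clog one_lt_two (q.den + 1)
  have h2 : 2 ^ Nat.clog 2 (q.den + 1) ≤ 2 ^ ratSize q :=
    Nat.pow_le_pow_right two_pos (by unfold ratSize; omega)
  omega

theorem ratSize_neg (q : ℚ) : ratSize (-q) = ratSize q := by
  simp [ratSize]

/-- As `|q| ≤ 1`, the denominator also bounds the numerator; each logarithm is at most `t + 1`. -/
theorem ratSize_le_of_den_le {q : ℚ} {t : ℕ} (hq : |q| ≤ 1) (hden : q.den ≤ 2 ^ t) :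
    ratSize q ≤ 2 * t + 3 := by
  have hnum : q.num.natAbs ≤ q.den := by
    have h : |q| = (q.num.natAbs : ℚ) / q.den := by
      rw [Rat.abs_def, Rat.divInt_eq_div]
      simp
    rw [h, div_le_one (by exact_mod_cast q.den_pos)] at hq
    exact_mod_cast hq
  have hclog : ∀ m ≤ 2 ^ t, Nat.clog 2 (m + 1) ≤ t + 1 := by
    intro m hm
    apply Nat.clog_le_of_le_pow
    rw [pow_succ]
    have := Nat.one_le_two_pow (n := t)
    omega
  have h1 := hclog _ hden
  have h2 := hclog _ (hnum.trans hden)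
  unfold ratSize
  omega

theorem exists_ratCast_eq_of_realSize_ne_top {x : ℝ} (hx : realSize x ≠ ⊤) :
    ∃ q : ℚ, (q : ℝ) = x := by
  by_contra h
  exact hx (dif_neg h)

/-- By Cramer's rule, the denominators of the solution of an integral linear system are at most
the absolute value of the determinant. -/
theorem exists_rat_den_le_natAbs_det {n : Type*} [Fintype n] [DecidableEq n] {M : Matrix n n ℤ}
    {t : n → ℤ} {c : n → ℝ} (hdet : M.det ≠ 0)
    (h : ∀ i, ∑ j, (M i j : ℝ) * c j = t i) (i : n) :
    ∃ q : ℚ, (q : ℝ) = c i ∧ q.den ≤ M.det.natAbs := by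
  have h1 : (M.map (Int.castRingHom ℝ)).mulVec c = fun i => (t i : ℝ) := funext h
  have h2 : (M.det : ℝ) * c i = ((M.adjugate.mulVec t i : ℤ) : ℝ) := by
    have h3 : ((M.map (Int.castRingHom ℝ)).adjugate.mulVec
        ((M.map (Int.castRingHom ℝ)).mulVec c)) i = (M.det : ℝ) * c i := by
      rw [Matrix.mulVec_mulVec, Matrix.adjugate_mul, Matrix.smul_mulVec, Matrix.one_mulVec]
      have h4 : (M.map (Int.castRingHom ℝ)).det = (M.det : ℝ) :=
        ((Int.castRingHom ℝ).map_det M).symm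
      rw [h4, Pi.smul_apply, smul_eq_mul]
    rw [← h3, h1]
    have h5 : (M.map (Int.castRingHom ℝ)).adjugate = M.adjugate.map (Int.castRingHom ℝ) :=
      ((Int.castRingHom ℝ).map_adjugate M).symm
    rw [h5]
    simp [Matrix.mulVec, dotProduct]
  refine ⟨Rat.divInt (M.adjugate.mulVec t i) M.det, ?_, ?_⟩
  · have : (M.det : ℝ) ≠ 0 := by exact_mod_cast hdet
    rw [Rat.divInt_eq_div, Rat.cast_div, Rat.cast_intCast, Rat.cast_intCast, ← h2,
      mul_div_cancel_left₀ _ this]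
  · have := Int.natAbs_dvd_natAbs.2 (Rat.den_dvd (M.adjugate.mulVec t i) M.det)
    exact Nat.le_of_dvd (Int.natAbs_pos.2 hdet) (by simpa using this)

/-- The Leibniz expansion has `n!` terms, and `n! ≤ N ^ N ≤ (2 ^ N) ^ N`. -/
theorem natAbs_det_le {n : Type*} [Fintype n] [DecidableEq n] {M : Matrix n n ℤ} {N : ℕ}
    (hN : Fintype.card n ≤ N) (hM : ∀ i j, (M i j).natAbs ≤ 2 ^ N) :
    M.det.natAbs ≤ 2 ^ (2 * N ^ 2) := by
  have h1 : |M.det| ≤ (Fintype.card n).factorial • ((2 : ℤ) ^ N) ^ Fintype.card n := by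
    refine Matrix.det_le (abv := AbsoluteValue.abs) fun i j => ?_
    have := hM i j
    change |M i j| ≤ _
    rw [Int.abs_eq_natAbs]
    exact_mod_cast this
  have h2 : M.det.natAbs ≤ (Fintype.card n).factorial * (2 ^ N) ^ Fintype.card n := by
    rw [Int.abs_eq_natAbs, nsmul_eq_mul] at h1
    exact_mod_cast h1
  have h3 : (Fintype.card n).factorial ≤ (2 ^ N) ^ N :=
    calc (Fintype.card n).factorial ≤ N.factorial := Nat.factorial_le hN
      _ ≤ N ^ N := Nat.factorial_le_pow N
      _ ≤ (2 ^ N) ^ N := Nat.pow_le_pow_left Nat.lt_two_pow_self.le N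
  calc M.det.natAbs ≤ (2 ^ N) ^ N * (2 ^ N) ^ N :=
        h2.trans (Nat.mul_le_mul h3 (Nat.pow_le_pow_right (by positivity) hN))
    _ = 2 ^ (2 * N ^ 2) := by ring

/-- Clearing denominators in the homogenization of a rational point. -/
theorem exists_int_multiple_homogenize {D : Type*} [Fintype D] [DecidableEq D] (q : D → ℚ) :
    ∃ (s : ℤ) (w : Option D → ℤ), s ≠ 0 ∧
      (∀ o, (w o : ℝ) = s * homogenize (fun d => (q d : ℝ)) o) ∧
      ∀ o, (w o).natAbs ≤ 2 ^ ∑ d, ratSize (q d) := by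
  refine ⟨∏ d, ((q d).den : ℤ),
    fun o => o.elim (∏ d, ((q d).den : ℤ))
      fun d => (q d).num * ∏ d' ∈ Finset.univ.erase d, ((q d').den : ℤ), ?_, ?_, ?_⟩
  · exact Finset.prod_ne_zero_iff.2 fun d _ => by exact_mod_cast (q d).den_ne_zero
  · rintro (_ | d)
    · simp [homogenize]
    · simp only [homogenize, Option.elim]
      rw [← Finset.mul_prod_erase _ _ (Finset.mem_univ d)]
      have hd : ((q d).den : ℝ) ≠ 0 := by exact_mod_cast (q d).den_ne_zero
      have : ((q d : ℚ) : ℝ) = (q d).num / (q d).den := Rat.cast_def _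
      rw [this]
      push_cast
      field_simp
  · rintro (_ | d)
    · simp only [Option.elim]
      rw [← Nat.cast_prod, Int.natAbs_natCast, ← Finset.prod_pow_eq_pow_sum]
      exact Finset.prod_le_prod' fun d _ => den_le_two_pow_ratSize (q d)
    · simp only [Option.elim]
      rw [← Nat.cast_prod, Int.natAbs_mul, Int.natAbs_natCast, ← Finset.prod_pow_eq_pow_sum,
        ← Finset.mul_prod_erase _ _ (Finset.mem_univ d)]
      exact Nat.mul_le_mul (natAbs_num_le_two_pow_ratSize _)
        (Finset.prod_le_prod' fun d _ => den_le_two_pow_ratSize (q d))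

/-- The extreme points of the boxed dual cone of a set of small rational points are small. -/
theorem exists_rat_of_mem_extremePoints_boxedCone {D : Type*} [Fintype D] [DecidableEq D]
    {X : Finset (D → ℝ)} {N : ℕ} (hD : Fintype.card D + 1 ≤ N)
    (hX : ∀ x ∈ X, ∃ q : D → ℚ, (x = fun d => (q d : ℝ)) ∧ ∑ d, ratSize (q d) ≤ N)
    {c : Option D → ℝ} (hc : c ∈ Set.extremePoints ℝ
      (polyhedron (boxedConeRow fun x : X => homogenize x.1) boxedConeBound)) (o : Option D) :
    ∃ q : ℚ, (q : ℝ) = c o ∧ ratSize q ≤ 4 * N ^ 2 + 3 := by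
  -- Each constraint is scaled to integers. The right-hand side `t` needs no bound, because only
  -- denominators are read off from Cramer's rule.
  have hrow : ∀ j : X ⊕ Option D ⊕ Option D, ∃ (s t : ℤ) (w : Option D → ℤ), s ≠ 0 ∧
      (∀ o, (w o : ℝ) = s * boxedConeRow (fun x : X => homogenize x.1) j o) ∧
      (t : ℝ) = s * boxedConeBound j ∧ ∀ o, (w o).natAbs ≤ 2 ^ N := by
    have hone := Nat.one_le_two_pow (n := N)
    rintro (x | i | i)
    · obtain ⟨q, hq, hqN⟩ := hX x.1 x.2
      obtain ⟨s, w, hs, hw, hwN⟩ := exists_int_multiple_homogenize q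
      refine ⟨s, 0, w, hs, fun o => ?_, by simp [boxedConeBound],
        fun o => (hwN o).trans (Nat.pow_le_pow_right two_pos hqN)⟩
      rw [hw, ← hq]
      rfl
    · refine ⟨1, -1, Pi.single i 1, one_ne_zero, fun o => ?_, by simp [boxedConeBound],
        fun o => ?_⟩
      · simp only [boxedConeRow, Sum.elim_inr, Sum.elim_inl, Pi.single_apply]
        split_ifs <;> simp
      · rw [Pi.single_apply]
        split_ifs <;> simp [hone]
    · refine ⟨1, -1, -Pi.single i 1, one_ne_zero, fun o => ?_, by simp [boxedConeBound],
        fun o => ?_⟩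
      · simp only [boxedConeRow, Sum.elim_inr, Pi.neg_apply, Pi.single_apply]
        split_ifs <;> simp
      · rw [Pi.neg_apply, Int.natAbs_neg, Pi.single_apply]
        split_ifs <;> simp [hone]
  choose s t w hs hw ht hwN using hrow
  obtain ⟨f, hdet, hf⟩ := exists_active_basis hc
  set M : Matrix (Option D) (Option D) ℤ := Matrix.of fun i => w (f i)
  have hM : M.det ≠ 0 := by
    have h1 : (M.det : ℝ) = (∏ i, (s (f i) : ℝ)) *
        (Matrix.of fun i => boxedConeRow (fun x : X => homogenize x.1) (f i)).det := by
      rw [← Matrix.det_mul_column]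
      refine ((Int.castRingHom ℝ).map_det M).trans (congrArg Matrix.det ?_)
      ext i j
      exact hw (f i) j
    have h2 : (M.det : ℝ) ≠ 0 := by
      rw [h1]
      exact mul_ne_zero (Finset.prod_ne_zero_iff.2 fun i _ => by exact_mod_cast hs (f i)) hdet
    exact_mod_cast h2
  obtain ⟨q, hq, hqden⟩ := exists_rat_den_le_natAbs_det (M := M) (t := fun i => t (f i))
    (c := c) hM (fun i => by
      rw [ht, ← hf i, dotProduct, Finset.mul_sum]
      refine Finset.sum_congr rfl fun j _ => ?_
      rw [← mul_assoc, ← hw]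
      rfl) o
  refine ⟨q, hq, ?_⟩
  have hcard : Fintype.card (Option D) ≤ N := by rwa [Fintype.card_option]
  have hbox := (mem_boxedCone.1 hc.1).2
  have hq1 : |q| ≤ 1 := by
    have : |(q : ℝ)| ≤ 1 := by
      rw [hq]
      exact abs_le.2 ⟨hbox.1 o, hbox.2 o⟩
    exact_mod_cast this
  have := ratSize_le_of_den_le hq1 (hqden.trans (natAbs_det_le hcard fun i j => hwN (f i) j))
  omega

/-! ### The polynomial bound -/

theorem mainTheorem9 :
    ∃ P : Polynomial ℕ, ∀ (D : Type*) [Fintype D] (X : Finset (D → ℝ)), X.Nonempty →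
      ∃ S : Finset (LinearInequation D),
        systemSol S = convexHull ℝ (X : Set (D → ℝ)) ∧
          ∀ e ∈ S, e.size ≤ polyValue P (pointSetSize X) := by
  -- The `card D + 1 ≤ N` entries of `(a, b)` cost at most `4 * N ^ 2 + 3` each, and the remaining
  -- terms are `2 + card D`.
  refine ⟨4 * Polynomial.X ^ 3 + 4 * Polynomial.X + 2, fun D _ X hX => ?_⟩
  classical
  obtain ⟨S, hS, hSE⟩ := exists_system_convexHull X hX
  refine ⟨S, hS, fun e he => ?_⟩
  have hP : ∀ m : ℕ∞, polyValue (4 * Polynomial.X ^ 3 + 4 * Polynomial.X + 2) m =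
      4 * m ^ 3 + 4 * m + 2 := by
    intro m
    have h4 : (4 : Polynomial ℕ) = Polynomial.C 4 := rfl
    have h2 : (2 : Polynomial ℕ) = Polynomial.C 2 := rfl
    rw [polyValue, h4, h2]
    simp only [Polynomial.eval₂_add, Polynomial.eval₂_mul, Polynomial.eval₂_pow,
      Polynomial.eval₂_X, Polynomial.eval₂_C]
    simp
  rw [hP]
  by_cases htop : pointSetSize X = ⊤
  · rw [htop]
    simp [ENat.mul_top]
  obtain ⟨N, hN⟩ := ENat.ne_top_iff_exists.1 htop
  -- The extra `1` comes from `card X ≥ 1`; it pays for the homogenizing coordinate in `hD`.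
  have hpoint : ∀ x ∈ X, pointSize x + 1 ≤ N := by
    intro x hx
    rw [hN, pointSetSize, add_comm]
    refine add_le_add ?_ (Finset.single_le_sum (f := pointSize) (fun _ _ => zero_le) hx)
    exact_mod_cast hX.card_pos
  have hD : Fintype.card D + 1 ≤ N := by
    obtain ⟨x, hx⟩ := hX
    have : ((Fintype.card D : ℕ∞) + 1) ≤ N :=
      (add_le_add_left le_self_add 1).trans (hpoint x hx)
    exact_mod_cast this
  have hrat : ∀ x ∈ X, ∃ q : D → ℚ, (x = fun d => (q d : ℝ)) ∧ ∑ d, ratSize (q d) ≤ N := by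
    intro x hx
    have h1 : ∑ d, realSize (x d) ≤ N :=
      le_add_self.trans (le_self_add.trans (hpoint x hx))
    have h2 : ∀ d, ∃ q : ℚ, (q : ℝ) = x d := fun d =>
      exists_ratCast_eq_of_realSize_ne_top (ne_top_of_le_ne_top (ENat.natCast_ne_top N)
        ((Finset.single_le_sum (f := fun d => realSize (x d)) (fun _ _ => zero_le)
          (Finset.mem_univ d)).trans h1))
    choose q hq using h2
    refine ⟨q, funext fun d => (hq d).symm, ?_⟩
    simp only [← hq, realSize_ratCast] at h1
    exact_mod_cast h1
  have hsmall := exists_rat_of_mem_extremePoints_boxedCone hD hrat (hSE e he)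
  have ha : ∀ d, realSize (e.1.1 d) ≤ ((4 * N ^ 2 + 3 : ℕ) : ℕ∞) := by
    intro d
    obtain ⟨q, hq, hqN⟩ := hsmall (some d)
    simp only [Option.elim] at hq
    rw [← hq, realSize_ratCast]
    exact_mod_cast hqN
  have hb : realSize e.2 ≤ ((4 * N ^ 2 + 3 : ℕ) : ℕ∞) := by
    obtain ⟨q, hq, hqN⟩ := hsmall none
    simp only [Option.elim] at hq
    have hq' : ((-q : ℚ) : ℝ) = e.2 := by
      push_cast
      linarith
    rw [← hq', realSize_ratCast, ratSize_neg]
    exact_mod_cast hqN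
  have hsum : ∑ d, realSize (e.1.1 d) ≤ ((Fintype.card D * (4 * N ^ 2 + 3) : ℕ) : ℕ∞) := by
    refine (Finset.sum_le_sum fun d _ => ha d).trans (le_of_eq ?_)
    rw [Finset.sum_const, Finset.card_univ, nsmul_eq_mul, ← Nat.cast_mul]
  have hbound : e.size ≤ ((2 + (Fintype.card D + Fintype.card D * (4 * N ^ 2 + 3) +
      (4 * N ^ 2 + 3)) : ℕ) : ℕ∞) := by
    rw [LinearInequation.size, pointSize]
    push_cast at hsum hb ⊢
    gcongr
  rw [← hN]
  refine hbound.trans ?_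
  have hnat : 2 + (Fintype.card D + Fintype.card D * (4 * N ^ 2 + 3) + (4 * N ^ 2 + 3)) ≤
      4 * N ^ 3 + 4 * N + 2 := by
    have := Nat.mul_le_mul_right (4 * N ^ 2 + 3) hD
    have h3 : N * (4 * N ^ 2 + 3) = 4 * N ^ 3 + 3 * N := by ring
    rw [h3, add_mul] at this
    omega
  exact_mod_cast hnat
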